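/- A finite set $P$ of points in the Euclidean plane is in convex position if no point of $P$ lies in the convex hull of the others. The complete geometric graph $K_n$ on a set $P$ of $n$ points has vertex set $P$ and all straight-line segments joining two points of $P$ as edges; two distinct edges cross if they have a common point in the relative interior of both. A 1-plane Hamiltonian cycle (1-PHC) on $P$ is a Hamiltonian cycle of $K_n$ each of whose edges is crossed by at most one other edge of the cycle. Theorem. Let $P$ be a set of $n \ge 3$ points in convex position in the plane, and let $k \ge 0$ be an integer. There exist $k$ pairwise edge-disjoint 1-PHCs on $P$ if and only if $k \le \lfloor n/3 \rfloor$. In other words, at most $\lfloor n/3\rfloor$ edge-disjoint 1-PHCs can be packed into the complete geometric graph $K_n$ on $P$, and this bound is attained for every such $P$. -/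

import Mathlib

/-- The Euclidean plane. -/
abbrev Plane : Type := EuclideanSpace ℝ (Fin 2)

/-- A finite point set is in convex position if no point of it lies in the convex hull of the
others. -/
def InConvexPosition (P : Finset Plane) : Prop :=
  ConvexIndependent ℝ (fun p : P => (p : Plane))

/-- The relative interior of the straight-line segment that represents an edge of a geometric
graph on `P`. -/
def edgeInterior {P : Finset Plane} (e : Sym2 P) : Set Plane :=
  Sym2.lift ⟨fun a b : P => openSegment ℝ (a : Plane) (b : Plane),
    fun a b => openSegment_symm ℝ (a : Plane) (b : Plane)⟩ e

/-- Two distinct edges cross if the corresponding segments have a common point that is interior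
to both. -/
def EdgesCross {P : Finset Plane} (e f : Sym2 P) : Prop :=
  e ≠ f ∧ (edgeInterior e ∩ edgeInterior f).Nonempty

/-- A geometric graph on `P` (a simple graph on the vertex set `P`, drawn with straight-line
edges) is 1-plane if each of its edges is crossed by at most one of its edges. -/
def IsOnePlane {P : Finset Plane} (G : SimpleGraph P) : Prop :=
  ∀ e ∈ G.edgeSet, {f ∈ G.edgeSet | EdgesCross e f}.encard ≤ 1

open Classical in
/-- A graph is a Hamiltonian cycle (on its whole vertex set) if it contains a closed walk that is
a Hamiltonian cycle and that uses all its edges. -/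
def IsHamiltonianCycleGraph {V : Type*} (G : SimpleGraph V) : Prop :=
  ∃ (v : V) (w : G.Walk v v), w.IsHamiltonianCycle ∧ ∀ e ∈ G.edgeSet, e ∈ w.edges

/-- A 1-plane Hamiltonian cycle on `P`. -/
def IsOnePHC {P : Finset Plane} (G : SimpleGraph P) : Prop :=
  IsHamiltonianCycleGraph G ∧ IsOnePlane G

/-- A packing of `k` 1-plane Hamiltonian cycles into the complete geometric graph on `P`:
`k` pairwise edge-disjoint 1-plane Hamiltonian cycles. -/
def IsOnePHCPacking {P : Finset Plane} (k : ℕ) (C : Fin k → SimpleGraph P) : Prop :=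
  (∀ i, IsOnePHC (C i)) ∧ ∀ i j, i ≠ j → Disjoint (C i).edgeSet (C j).edgeSet

/-! Label the points cyclically by `ZMod n`; two edges cross exactly when their endpoints interlace,
so both directions become statements about labels.

Upper bound: give each cycle one unit for every hull edge it uses, and one for every corner, a point
`s` such that the cycle contains the chord from `s - 1` to `s + 1` or both hull edges at `s`. Each
cycle earns at least 6 (`IsPeriodicOnePHC.six_le`): a chord leaves two arcs, and by
`exists_corner_or_cap` each arc gives either two hull edges and one corner or one hull edge and two
corners; a cycle without chords is the hull itself. Edge-disjoint cycles share no hull edge. They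
share no corner either, since a cycle with the chord over `s` also uses a hull edge at `s`
(`adj_or_adj_of_chord`). So `6 * k ≤ 2 * n`.

Construction: in a regular polygon the edges with a fixed label sum `x + y` are parallel. A zigzag
with axis `p` uses only the sums `p - 1`, `p`, `p + 1`, with sum `p` only on hull edges. An edge of
sum `p - 1` can cross only its translate by one, of sum `p + 1`, and conversely, so the zigzag is
1-plane. The axes `0, 3, 6, …` use disjoint sets of sums as long as `3 * k ≤ n`. -/

/-! ### Orientation and the cyclic order of points in convex position. -/

/-- Twice the signed area of the triangle `p q r`. -/
def orient (p q r : Plane) : ℝ :=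
  (q 0 - p 0) * (r 1 - p 1) - (q 1 - p 1) * (r 0 - p 0)

theorem plane_ext {p q : Plane} (h0 : p 0 = q 0) (h1 : p 1 = q 1) : p = q := by
  ext i
  fin_cases i
  · exact h0
  · exact h1

theorem InConvexPosition.ne_combination {P : Finset Plane} (hP : InConvexPosition P)
    {q x y z : P} (hx : q ≠ x) (hy : q ≠ y) (hz : q ≠ z) {α β γ : ℝ} (hα : 0 ≤ α) (hβ : 0 ≤ β)
    (hγ : 0 ≤ γ) (hs : α + β + γ = 1) :
    (q : Plane) ≠ α • (x : Plane) + β • (y : Plane) + γ • (z : Plane) := by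
  intro h
  have hmem : (q : Plane) ∈ convexHull ℝ ((fun p : P => (p : Plane)) '' {x, y, z}) := by
    have := (convex_convexHull ℝ ((fun p : P => (p : Plane)) '' {x, y, z})).sum_mem
      (t := (Finset.univ : Finset (Fin 3))) (w := ![α, β, γ])
      (z := ![(x : Plane), (y : Plane), (z : Plane)]) ?_ ?_ ?_
    · rw [h]
      simpa [Fin.sum_univ_three] using this
    · intro i _
      fin_cases i <;> simpa
    · simpa [Fin.sum_univ_three] using hs
    · intro i _
      apply subset_convexHull ℝ
      fin_cases i
      · exact ⟨x, by simp, rfl⟩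
      · exact ⟨y, by simp, rfl⟩
      · exact ⟨z, by simp, rfl⟩
  have := hP {x, y, z} q hmem
  simp_all

/-- A point in convex position is strictly separated from the others by a linear functional. -/
theorem InConvexPosition.exists_functional {P : Finset Plane} (hP : InConvexPosition P) (o : P) :
    ∃ F₀ F₁ : ℝ, ∀ q : P, q ≠ o →
      0 < F₀ * ((q : Plane) 0 - (o : Plane) 0) + F₁ * ((q : Plane) 1 - (o : Plane) 1) := by
  set S : Set Plane := (fun p : P => (p : Plane)) '' {q | q ≠ o} with hS
  have hfin : S.Finite := Set.toFinite _
  have ho : (o : Plane) ∉ convexHull ℝ S := fun h => hP {q | q ≠ o} o h rfl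
  obtain ⟨f, u, hu, hf⟩ := geometric_hahn_banach_point_closed (convex_convexHull ℝ S)
    (hfin.isClosed_convexHull ℝ) ho
  have key : ∀ w : Plane, f w = f (EuclideanSpace.single 0 1) * w 0
      + f (EuclideanSpace.single 1 1) * w 1 := by
    intro w
    have : w = w 0 • (EuclideanSpace.single 0 1 : Plane)
        + w 1 • (EuclideanSpace.single 1 1 : Plane) := by
      apply plane_ext <;> simp
    conv_lhs => rw [this]
    rw [map_add, map_smul, map_smul]
    simp only [smul_eq_mul]
    ring
  refine ⟨f (EuclideanSpace.single 0 1), f (EuclideanSpace.single 1 1), fun q hq => ?_⟩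
  have h1 := hf q (subset_convexHull ℝ S ⟨q, hq, rfl⟩)
  rw [key] at h1 hu
  linarith

theorem exists_orient_pos {P : Finset Plane} (hP : InConvexPosition P) {n : ℕ}
    (hn : P.card = n) (hpos : 0 < n) :
    ∃ u : Fin n ≃ P, ∀ i j k, i < j → j < k → 0 < orient (u i) (u j) (u k) := by
  classical
  obtain ⟨o', ho'⟩ : P.Nonempty := Finset.card_pos.mp (hn ▸ hpos)
  set o : P := ⟨o', ho'⟩
  obtain ⟨F₀, F₁, hF⟩ := hP.exists_functional o
  set f : P → ℝ := fun q =>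
    F₀ * ((q : Plane) 0 - (o : Plane) 0) + F₁ * ((q : Plane) 1 - (o : Plane) 1) with hf
  set h : P → ℝ := fun q =>
    F₀ * ((q : Plane) 1 - (o : Plane) 1) - F₁ * ((q : Plane) 0 - (o : Plane) 0) with hh
  have hcross : ∀ a b : P, f a * h b - f b * h a = (F₀ ^ 2 + F₁ ^ 2) * orient o a b := by
    intro a b
    simp only [hf, hh, orient]
    ring
  have hN : ∀ q : P, q ≠ o → 0 < F₀ ^ 2 + F₁ ^ 2 := by
    intro q hq
    have h1 := hF q hq
    rcases eq_or_ne F₀ 0 with h0 | h0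
    · rcases eq_or_ne F₁ 0 with h2 | h2
      · simp [h0, h2] at h1
      · positivity
    · positivity
  -- Were `a` and `b` on one ray from `o`, the one with smaller `f` would lie on the segment from
  -- `o` to the other.
  have hpar : ∀ a b : P, a ≠ o → b ≠ o → a ≠ b → f a ≤ f b → f a * h b ≠ f b * h a := by
    intro a b ha hb hab hle heq
    have hfa := hF a ha
    have hfb := hF b hb
    change 0 < f a at hfa
    change 0 < f b at hfb
    have hNb := hN b hb
    have hl : f a / f b ≤ 1 := (div_le_one hfb).2 hle
    refine hP.ne_combination (q := a) (x := o) (y := b) (z := b) ha hab hab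
      (α := 1 - f a / f b) (β := f a / f b) (γ := 0) (by linarith) (by positivity) le_rfl
      (by ring) ?_
    have e0 : ((a : Plane) 0 - (o : Plane) 0) * f b = f a * ((b : Plane) 0 - (o : Plane) 0) := by
      apply mul_left_cancel₀ hNb.ne'
      have : F₁ * (f a * h b) = F₁ * (f b * h a) := by rw [heq]
      simp only [hf, hh] at this ⊢
      linear_combination this
    have e1 : ((a : Plane) 1 - (o : Plane) 1) * f b = f a * ((b : Plane) 1 - (o : Plane) 1) := by
      apply mul_left_cancel₀ hNb.ne'
      have : F₀ * (f a * h b) = F₀ * (f b * h a) := by rw [heq]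
      simp only [hf, hh] at this ⊢
      linear_combination -this
    apply plane_ext
    · simp only [PiLp.add_apply, PiLp.smul_apply, smul_eq_mul]
      field_simp
      linear_combination e0
    · simp only [PiLp.add_apply, PiLp.smul_apply, smul_eq_mul]
      field_simp
      linear_combination e1
  -- Sort by slope as seen from `o`, in coordinates where all other points lie in the half-plane `f
  -- > 0`; `⊥` puts `o` itself first.
  set key : P → WithBot ℝ := fun q => if q = o then ⊥ else ((h q / f q : ℝ) : WithBot ℝ) with hkey
  have hko : key o = ⊥ := by simp [hkey]
  have hkn : ∀ q, q ≠ o → key q = ((h q / f q : ℝ) : WithBot ℝ) := by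
    intro q hq
    simp [hkey, hq]
  have hinj : Function.Injective key := by
    intro a b hab
    by_contra hne
    rcases eq_or_ne a o with ha | ha
    · have hb : b ≠ o := fun hb => hne (ha.trans hb.symm)
      rw [ha, hko, hkn b hb] at hab
      exact WithBot.bot_ne_coe hab
    · rcases eq_or_ne b o with hb | hb
      · rw [hb, hko, hkn a ha] at hab
        exact WithBot.coe_ne_bot hab
      · rw [hkn a ha, hkn b hb, WithBot.coe_inj,
          div_eq_div_iff (hF a ha).ne' (hF b hb).ne'] at hab
        rcases le_total (f a) (f b) with hle | hle
        · exact hpar a b ha hb hne hle (by linear_combination -hab)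
        · exact hpar b a hb ha (Ne.symm hne) hle (by linear_combination hab)
  have hslope : ∀ a b : P, a ≠ o → b ≠ o → key a < key b → 0 < orient o a b := by
    intro a b ha hb hab
    rw [hkn a ha, hkn b hb, WithBot.coe_lt_coe, div_lt_div_iff₀ (hF a ha) (hF b hb)] at hab
    refine pos_of_mul_pos_right (a := F₀ ^ 2 + F₁ ^ 2) ?_ (hN a ha).le
    rw [← hcross]
    linarith
  have hmain : ∀ a b c : P, key a < key b → key b < key c → 0 < orient a b c := by
    intro a b c hab hbc
    have hb : b ≠ o := by
      rintro rfl
      rw [hko] at hab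
      exact not_lt_bot hab
    have hc : c ≠ o := by
      rintro rfl
      rw [hko] at hbc
      exact not_lt_bot hbc
    rcases eq_or_ne a o with ha | ha
    · rw [ha]
      exact hslope b c hb hc hbc
    · have h1 := hslope a b ha hb hab
      have h2 := hslope b c hb hc hbc
      have h3 := hslope a c ha hc (hab.trans hbc)
      by_contra hneg
      push Not at hneg
      have hid : orient a b c = orient o a b + orient o b c - orient o a c := by
        simp only [orient]
        ring
      -- If `a, b, c` did not turn left, `b` would lie in the triangle `o a c`; the weights are its
      -- barycentric coordinates as ratios of areas.
      refine hP.ne_combination (q := b) (x := o) (y := a) (z := c) hb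
        (fun h => by subst h; exact lt_irrefl _ hab) (fun h => by subst h; exact lt_irrefl _ hbc)
        (α := - orient a b c / orient o a c) (β := orient o b c / orient o a c)
        (γ := orient o a b / orient o a c) (div_nonneg (by linarith) h3.le)
        (by positivity) (by positivity) ?_ ?_
      · field_simp
        linarith
      · apply plane_ext
        · simp only [PiLp.add_apply, PiLp.smul_apply, smul_eq_mul]
          field_simp
          simp only [orient]
          ring
        · simp only [PiLp.add_apply, PiLp.smul_apply, smul_eq_mul]
          field_simp
          simp only [orient]
          ring
  let _ : LinearOrder P := LinearOrder.lift' key hinj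
  have hlt : ∀ a b : P, a < b → key a < key b := fun a b hab => hab
  let u : Fin n ≃o P := Fintype.orderIsoFinOfCardEq P (by simp [hn])
  refine ⟨u.toEquiv, fun i j k hij hjk => hmain _ _ _ ?_ ?_⟩
  · exact hlt _ _ (u.lt_iff_lt.2 hij)
  · exact hlt _ _ (u.lt_iff_lt.2 hjk)

/-- A labelling of the points by `ZMod n` in counterclockwise order. -/
def IsCyclicLabelling {P : Finset Plane} {n : ℕ} (v : ZMod n ≃ P) : Prop :=
  ∀ a b c : ℤ, a < b → b < c → c < a + n → 0 < orient (v a) (v b) (v c)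

theorem orient_rotate (p q r : Plane) : orient p q r = orient q r p := by
  simp only [orient]
  ring

theorem exists_isCyclicLabelling {P : Finset Plane} (hP : InConvexPosition P) {n : ℕ}
    (hn : P.card = n) (hpos : 0 < n) : ∃ v : ZMod n ≃ P, IsCyclicLabelling v := by
  obtain ⟨u, hu⟩ := exists_orient_pos hP hn hpos
  obtain ⟨m, rfl⟩ : ∃ m, n = m + 1 := ⟨n - 1, by omega⟩
  let v : ZMod (m + 1) ≃ P := u
  have hv : ∀ a b c : ℤ, 0 ≤ a → a < b → b < c → c < (m + 1 : ℕ) →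
      0 < orient (v a) (v b) (v c) := by
    intro a b c ha hab hbc hc
    lift a to ℕ using ha
    lift b to ℕ using by omega
    lift c to ℕ using by omega
    have hlt : ∀ x y : ℕ, x < y → y < m + 1 →
        ZMod.val ((x : ℤ) : ZMod (m + 1)) < ZMod.val ((y : ℤ) : ZMod (m + 1)) := by
      intro x y hxy hy
      rw [Int.cast_natCast, Int.cast_natCast, ZMod.val_natCast_of_lt (by omega),
        ZMod.val_natCast_of_lt hy]
      exact hxy
    exact hu _ _ _ (hlt a b (by omega) (by omega)) (hlt b c (by omega) (by omega))
  refine ⟨v, fun a b c hab hbc hc => ?_⟩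
  have hper : ∀ z k : ℤ, ((z - (m + 1 : ℕ) * k : ℤ) : ZMod (m + 1)) = z := by
    intro z k
    push_cast
    have : ((m : ZMod (m + 1)) + 1) = 0 := by exact_mod_cast ZMod.natCast_self (m + 1)
    rw [this]
    ring
  have hq := Int.emod_add_mul_ediv a (m + 1 : ℕ)
  have h0 := Int.emod_nonneg a (b := (m + 1 : ℕ)) (by positivity)
  have h1 := Int.emod_lt_of_pos a (b := (m + 1 : ℕ)) (by positivity)
  set q := a / (m + 1 : ℕ)
  rw [← hper a q, ← hper b q, ← hper c q]
  have ha' : a - (m + 1 : ℕ) * q = a % (m + 1 : ℕ) := by linarith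
  generalize (m + 1 : ℕ) * q = t at *
  -- After the shift `a` lies in `[0, n)`. Labels that overrun `n` are wrapped back, which only
  -- rotates the triple cyclically.
  by_cases hb : b - t < (m + 1 : ℕ)
  · by_cases hc' : c - t < (m + 1 : ℕ)
    · exact hv _ _ _ (by omega) (by omega) (by omega) hc'
    · rw [← hper (c - t) 1, ← orient_rotate]
      exact hv _ _ _ (by omega) (by omega) (by omega) (by omega)
  · rw [← hper (c - t) 1, ← hper (b - t) 1, orient_rotate]
    exact hv _ _ _ (by omega) (by omega) (by omega) (by omega)

/-! ### Crossing edges and interlacing labels. -/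

theorem orient_lineMap {p q r s : Plane} {t u : ℝ} (h : t + u = 1) :
    orient p q (t • r + u • s) = t * orient p q r + u * orient p q s := by
  obtain rfl : t = 1 - u := by linarith
  simp only [orient, PiLp.add_apply, PiLp.smul_apply, smul_eq_mul]
  ring

theorem inter_openSegment_nonempty {a b c d : Plane} (h1 : 0 < orient a b c)
    (h2 : 0 < orient a b d) (h3 : 0 < orient a c d) (h4 : 0 < orient b c d) :
    (openSegment ℝ a c ∩ openSegment ℝ b d).Nonempty := by
  -- Twice the area of the quadrilateral, split along either diagonal. This common value is the
  -- denominator of the weights of the intersection point on both diagonals.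
  have hS : orient a b c + orient a c d = orient a b d + orient b c d := by
    simp only [orient]
    ring
  have hT : 0 < orient a b d + orient b c d := by linarith
  refine ⟨_, ⟨orient b c d / (orient a b d + orient b c d),
    orient a b d / (orient a b d + orient b c d), by positivity, by positivity,
    by field_simp; ring, rfl⟩, orient a c d / (orient a b d + orient b c d),
    orient a b c / (orient a b d + orient b c d), by positivity, by positivity,
    by field_simp; linarith, ?_⟩
  apply plane_ext <;>
  · simp only [PiLp.add_apply, PiLp.smul_apply, smul_eq_mul]
    field_simp
    simp only [orient]
    ring

theorem orient_mul_neg_of_cross {a b c d : Plane}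
    (h : (openSegment ℝ a b ∩ openSegment ℝ c d).Nonempty) :
    orient a b c * orient a b d < 0 ∨ orient a b c = 0 ∧ orient a b d = 0 := by
  obtain ⟨x, ⟨t, u, ht, hu, htu, hx⟩, t', u', ht', hu', htu', hx'⟩ := h
  have h1 : orient a b x = 0 := by
    rw [← hx, orient_lineMap htu]
    simp only [orient]
    ring
  rw [← hx', orient_lineMap htu'] at h1
  by_cases h0 : orient a b c = 0
  · right
    refine ⟨h0, ?_⟩
    rw [h0] at h1
    simpa [hu'.ne'] using h1
  · left
    have : t' * (orient a b c * orient a b c) + u' * (orient a b c * orient a b d) = 0 := by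
      linear_combination orient a b c * h1
    have hp : 0 < orient a b c * orient a b c := mul_self_pos.2 h0
    by_contra hneg
    push Not at hneg
    have := mul_pos ht' hp
    have := mul_nonneg hu'.le hneg
    linarith

namespace IsCyclicLabelling

variable {P : Finset Plane} {n : ℕ} {v : ZMod n ≃ P}

theorem edgesCross (hv : IsCyclicLabelling v) {a b c d : ℤ} (hab : a < b) (hbc : b < c)
    (hcd : c < d) (hd : d < a + n) : EdgesCross s(v a, v c) s(v b, v d) := by
  have hx := inter_openSegment_nonempty (hv a b c hab hbc (by omega))
    (hv a b d hab (by omega) hd) (hv a c d (by omega) hcd hd) (hv b c d hbc hcd (by omega))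
  refine ⟨fun h => ?_, hx⟩
  have h1 := hv a b c hab hbc (by omega)
  have h2 := hv a c d (by omega) hcd hd
  rw [Sym2.eq_iff] at h
  rcases h with ⟨h, h'⟩ | ⟨h, h'⟩
  · rw [h] at h1
    simp [orient] at h1
  · rw [h'] at h1
    simp only [orient] at h1
    ring_nf at h1
    exact lt_irrefl _ h1

/-- A crossing puts the ends of the second edge strictly on opposite sides of the first, and the
sign of `orient` tells which of the two arcs a label belongs to. Integer lifts absorb the
wrap-around. -/
theorem exists_of_edgesCross [NeZero n] (hv : IsCyclicLabelling v) {x y z w : ZMod n}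
    (hxy : x ≠ y) (hzw : z ≠ w) (h : EdgesCross s(v x, v y) s(v z, v w)) :
    ∃ a b c d : ℤ, a < b ∧ b < c ∧ c < d ∧ d < a + n ∧ s((a : ZMod n), (c : ZMod n)) = s(x, y) ∧
      s((b : ZMod n), (d : ZMod n)) = s(z, w) := by
  have key : ∀ i j k l : ℤ, 0 ≤ i → i < j → j < n → 0 ≤ k → k < n → 0 ≤ l → l < n → k ≠ l →
      EdgesCross s(v i, v j) s(v k, v l) →
      ∃ a b c d : ℤ, a < b ∧ b < c ∧ c < d ∧ d < a + n ∧
        s((a : ZMod n), (c : ZMod n)) = s((i : ZMod n), (j : ZMod n)) ∧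
        s((b : ZMod n), (d : ZMod n)) = s((k : ZMod n), (l : ZMod n)) := by
    intro i j k l hi hij hj hk hkn hl hln hkl hX
    obtain ⟨hne, hX⟩ := hX
    have hin : ∀ m : ℤ, i < m → m < j → orient (v i) (v j) (v m) < 0 := by
      intro m h1 h2
      have := hv i m j h1 h2 (by omega)
      simp only [orient] at this ⊢
      linarith
    have hout : ∀ m : ℤ, 0 ≤ m → m < n → (m < i ∨ j < m) → 0 < orient (v i) (v j) (v m) := by
      intro m h1 h2 h3
      rcases h3 with h3 | h3
      · rw [← orient_rotate]
        exact hv m i j h3 hij (by omega)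
      · exact hv i j m hij h3 (by omega)
    have hshift : ∀ m : ℤ, ((m + n : ℤ) : ZMod n) = m := by
      intro m
      simp
    rcases orient_mul_neg_of_cross hX with hneg | ⟨h1, h2⟩
    · rcases lt_trichotomy k i with h1 | h1 | h1
      · have h3 := hout k hk hkn (Or.inl h1)
        have h4 : i < l ∧ l < j := by
          by_contra hcon
          rcases eq_or_ne l i with h5 | h5
          · subst h5
            simp [orient] at hneg
          rcases eq_or_ne l j with h6 | h6
          · subst h6
            simp only [orient] at hneg
            ring_nf at hneg
            exact lt_irrefl _ hneg
          have := hout l hl hln (by omega)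
          have := mul_pos h3 this
          linarith
        exact ⟨i, l, j, k + n, h4.1, h4.2, by omega, by omega, rfl, by
          rw [hshift]; exact Sym2.eq_swap⟩
      · subst h1
        simp [orient] at hneg
      · rcases lt_trichotomy k j with h2 | h2 | h2
        · have h3 := hin k h1 h2
          have h4 : l < i ∨ j < l := by
            by_contra hcon
            rcases eq_or_ne l i with h5 | h5
            · subst h5
              simp [orient] at hneg
            rcases eq_or_ne l j with h6 | h6
            · subst h6
              simp only [orient] at hneg
              ring_nf at hneg
              exact lt_irrefl _ hneg
            have := hin l (by omega) (by omega)
            have := mul_pos_of_neg_of_neg h3 this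
            linarith
          rcases h4 with h4 | h4
          · exact ⟨i, k, j, l + n, h1, h2, by omega, by omega, rfl, by rw [hshift]⟩
          · exact ⟨i, k, j, l, h1, h2, by omega, by omega, rfl, rfl⟩
        · subst h2
          simp only [orient] at hneg
          ring_nf at hneg
          exact absurd hneg (lt_irrefl _)
        · have h3 := hout k hk hkn (Or.inr h2)
          have h4 : i < l ∧ l < j := by
            by_contra hcon
            rcases eq_or_ne l i with h5 | h5
            · subst h5
              simp [orient] at hneg
            rcases eq_or_ne l j with h6 | h6
            · subst h6
              simp only [orient] at hneg
              ring_nf at hneg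
              exact absurd hneg (lt_irrefl _)
            have := hout l hl hln (by omega)
            have := mul_pos h3 this
            linarith
          exact ⟨i, l, j, k, h4.1, h4.2, by omega, by omega, rfl, Sym2.eq_swap⟩
    -- Collinear case: only `i` and `j` have orientation zero, so both edges would coincide.
    · exfalso
      have hend : ∀ m : ℤ, 0 ≤ m → m < n → orient (v i) (v j) (v m) = 0 → m = i ∨ m = j := by
        intro m hm hmn h0
        by_contra hcon
        by_cases h3 : i < m ∧ m < j
        · exact (hin m h3.1 h3.2).ne h0
        · exact (hout m hm hmn (by omega)).ne' h0
      apply hne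
      rcases hend k hk hkn h1 with h3 | h3 <;> rcases hend l hl hln h2 with h4 | h4
      · omega
      · rw [h3, h4]
      · rw [h3, h4]
        exact Sym2.eq_swap
      · omega
  have hrep : ∀ x : ZMod n, ∃ i : ℤ, 0 ≤ i ∧ i < n ∧ (i : ZMod n) = x := fun x =>
    ⟨x.val, by positivity, by exact_mod_cast x.val_lt, by simp⟩
  obtain ⟨i, hi, hin, rfl⟩ := hrep x
  obtain ⟨j, hj, hjn, rfl⟩ := hrep y
  obtain ⟨k, hk, hkn, rfl⟩ := hrep z
  obtain ⟨l, hl, hln, rfl⟩ := hrep w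
  have hij : i ≠ j := fun h => hxy (by rw [h])
  have hkl : k ≠ l := fun h => hzw (by rw [h])
  rcases lt_or_gt_of_ne hij with hlt | hlt
  · exact key i j k l hi hlt hjn hk hkn hl hln hkl h
  · obtain ⟨a, b, c, d, h1, h2, h3, h4, h5, h6⟩ := key j i k l hj hlt hin hk hkn hl hln hkl
      (by rwa [Sym2.eq_swap])
    exact ⟨a, b, c, d, h1, h2, h3, h4, h5.trans Sym2.eq_swap, h6⟩

end IsCyclicLabelling

/-! ### Hamiltonian cycles as graphs. -/

namespace IsHamiltonianCycleGraph

variable {V : Type*} {G : SimpleGraph V}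

theorem ncard_neighborSet (h : IsHamiltonianCycleGraph G) (a : V) :
    (G.neighborSet a).ncard = 2 := by
  classical
  obtain ⟨v, w, hw, hedges⟩ := h
  have hw' : w.IsHamiltonianCycle := by convert hw
  have : G.neighborSet a = w.toSubgraph.neighborSet a := by
    ext b
    simp only [SimpleGraph.mem_neighborSet, SimpleGraph.Subgraph.mem_neighborSet]
    refine ⟨fun hb => ?_, fun hb => hb.adj_sub⟩
    rw [← SimpleGraph.Subgraph.mem_edgeSet, SimpleGraph.Walk.mem_edges_toSubgraph]
    exact hedges _ hb
  rw [this]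
  exact hw'.isCycle.ncard_neighborSet_toSubgraph_eq_two (hw'.mem_support a)

/-- A Hamiltonian cycle graph has no cut vertex. -/
theorem exists_adj_of_notMem (h : IsHamiltonianCycleGraph G) (a : V) (X : Set V) (haX : a ∉ X)
    {x y : V} (hx : x ∈ X) (hy : y ∉ X) (hya : y ≠ a) :
    ∃ x' ∈ X, ∃ y' ∉ X, y' ≠ a ∧ G.Adj x' y' := by
  classical
  obtain ⟨v, w', hw, hedges⟩ := h
  have hw' : w'.IsHamiltonianCycle := by convert hw
  -- Started at `a`, the cycle visits all other vertices along a path avoiding `a`; with no edge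
  -- leaving `X` there, membership in `X` is constant on it.
  have hw := hw'.rotate (hw'.mem_support a)
  set w := w'.rotate a (hw'.mem_support a)
  by_contra! hcon
  have hne : ∀ i, 1 ≤ i → i < w.length → w.getVert i ≠ a := by
    intro i hi hil heq
    have := hw.isCycle.getVert_injOn' (by simp; omega) (by simp)
        (heq.trans w.getVert_zero.symm)
    omega
  have hstep : ∀ i, 1 ≤ i → i < w.length → (w.getVert i ∈ X ↔ w.getVert 1 ∈ X) := by
    intro i hi
    induction i, hi using Nat.le_induction with
    | base => simp
    | succ i hi ih =>
      intro hil
      rw [← ih (by omega)]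
      have hadj := w.adj_getVert_succ (i := i) (by omega)
      constructor
      · intro h1
        by_contra h2
        exact hcon _ h1 _ h2 (hne i hi (by omega)) hadj.symm
      · intro h1
        by_contra h2
        exact hcon _ h1 _ h2 (hne (i + 1) (by omega) hil) hadj
  have hall : ∀ z, z ≠ a → (z ∈ X ↔ w.getVert 1 ∈ X) := by
    intro z hz
    obtain ⟨i, rfl, hil⟩ := SimpleGraph.Walk.mem_support_iff_exists_getVert.1 (hw.mem_support z)
    refine hstep i ?_ ?_
    · by_contra h0
      obtain rfl : i = 0 := by omega
      exact hz w.getVert_zero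
    · rcases hil.lt_or_eq with h0 | rfl
      · exact h0
      · exact absurd w.getVert_length hz
  have hxa : x ≠ a := fun h => haX (h ▸ hx)
  exact hy ((hall y hya).2 ((hall x hxa).1 hx))

end IsHamiltonianCycleGraph

theorem isHamiltonianCycleGraph_map_cycleGraph {V : Type*} {n : ℕ} (σ : Fin (n + 3) ≃ V) :
    IsHamiltonianCycleGraph ((SimpleGraph.cycleGraph (n + 3)).map σ.toEmbedding) := by
  classical
  set f := SimpleGraph.Iso.map σ (SimpleGraph.cycleGraph (n + 3))
  have hw : (SimpleGraph.cycleGraph.cycle n).IsHamiltonianCycle :=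
    SimpleGraph.Walk.isHamiltonianCycle_iff_isCycle_and_length_eq.2
      ⟨SimpleGraph.cycleGraph.isCycle_cycle, by simp⟩
  refine ⟨_, (SimpleGraph.cycleGraph.cycle n).map f.toHom, ?_, ?_⟩
  · convert hw.map (f := f.toHom) f.bijective
  -- The standard closed walk runs through the labels downwards, so its step number `n + 2 - u` goes
  -- from `u + 1` to `u`.
  · have hmem : ∀ u : Fin (n + 3), s(u + 1, u) ∈ (SimpleGraph.cycleGraph.cycle n).edges := by
      intro u
      have h1 := (SimpleGraph.cycleGraph.cycle n).toSubgraph_adj_getVert (i := n + 2 - u.val)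
        (by simp; omega)
      rw [SimpleGraph.cycleGraph.getVert_cycle (by omega),
        SimpleGraph.cycleGraph.getVert_cycle (by omega), ← SimpleGraph.Subgraph.mem_edgeSet,
        SimpleGraph.Walk.mem_edges_toSubgraph] at h1
      convert h1 using 2
      · ext
        rw [Fin.val_add]
        simp only [Fin.val_one]
        congr 1
        omega
      · ext
        simp only
        rw [show n + 3 - (n + 2 - u.val + 1) = u.val by omega, Nat.mod_eq_of_lt u.isLt]
    intro e he
    induction e with | _ a b =>
    rw [SimpleGraph.mem_edgeSet, SimpleGraph.map_adj] at he
    obtain ⟨u, u', hadj, rfl, rfl⟩ := he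
    rw [SimpleGraph.Walk.edges_map, List.mem_map]
    refine ⟨s(u, u'), ?_, rfl⟩
    rcases SimpleGraph.cycleGraph_adj.1 hadj with h | h
    · rw [← sub_add_cancel u u', h, add_comm 1 u']
      exact hmem u'
    · rw [← sub_add_cancel u' u, h, Sym2.eq_swap, add_comm 1 u]
      exact hmem u

/-! ### Local structure of a single 1-plane Hamiltonian cycle. -/

/-- The adjacency relation, lifted to an `n`-periodic relation on `ℤ`, of a 1-plane Hamiltonian
cycle on `n` points in convex position that are labelled in cyclic order. -/
structure IsPeriodicOnePHC (n : ℕ) (A : ℤ → ℤ → Prop) : Prop where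
  symm : ∀ i j, A i j → A j i
  add_left : ∀ i j, A (i + n) j ↔ A i j
  exists_two : ∀ i : ℤ, ∃ a b : ℤ, i < a ∧ a < b ∧ b < i + n ∧ A i a ∧ A i b ∧
    ∀ c, i < c → c < i + n → A i c → c = a ∨ c = b
  crossing_unique : ∀ a c b d b' d' : ℤ, a < b → b < c → c < d → d < a + n → a < b' → b' < c →
    c < d' → d' < a + n → A a c → A b d → A b' d' → b = b' ∧ d = d'
  no_cut_vertex : ∀ a b : ℤ, a < b → b + 1 < a + n →
    ∃ x y : ℤ, a ≤ x ∧ x < b ∧ b < y ∧ y < a + n ∧ A x y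

namespace IsPeriodicOnePHC

variable {n : ℕ} {A : ℤ → ℤ → Prop}

theorem add_right (h : IsPeriodicOnePHC n A) (i j : ℤ) : A i (j + n) ↔ A i j :=
  ⟨fun h' => h.symm _ _ ((h.add_left _ _).1 (h.symm _ _ h')),
    fun h' => h.symm _ _ ((h.add_left _ _).2 (h.symm _ _ h'))⟩

theorem not_three (h : IsPeriodicOnePHC n A) {i a b c : ℤ} (h1 : i < a) (h2 : a < b) (h3 : b < c)
    (h4 : c < i + n) (ha : A i a) (hb : A i b) (hc : A i c) : False := by
  obtain ⟨x, y, -, -, -, -, -, hxy⟩ := h.exists_two i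
  have := hxy a (by omega) (by omega) ha
  have := hxy b (by omega) (by omega) hb
  have := hxy c (by omega) (by omega) hc
  omega

/-- Reflection of the labelling, which supplies mirror images of one-sided lemmas. -/
theorem neg (h : IsPeriodicOnePHC n A) : IsPeriodicOnePHC n (fun i j => A (-i) (-j)) where
  symm i j := h.symm _ _
  add_left i j := by
    rw [← h.add_left]
    ring_nf
  exists_two i := by
    obtain ⟨a, b, h1, h2, h3, ha, hb, hc⟩ := h.exists_two (-i)
    refine ⟨n - b, n - a, by omega, by omega, by omega, ?_, ?_, fun c h4 h5 h6 => ?_⟩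
    · rw [← h.add_right]
      convert hb using 1
      ring
    · rw [← h.add_right]
      convert ha using 1
      ring
    · rw [← h.add_right] at h6
      have := hc _ (by omega) (by omega) h6
      omega
  crossing_unique a c b d b' d' h1 h2 h3 h4 h5 h6 h7 h8 hac hbd hbd' := by
    have hbd := (h.add_right _ _).2 hbd
    have hbd' := (h.add_right _ _).2 hbd'
    have := h.crossing_unique (-c) (-a) (-b) (-d + n) (-b') (-d' + n) (by omega) (by omega)
      (by omega) (by omega) (by omega) (by omega) (by omega) (by omega) (h.symm _ _ hac) hbd hbd'
    omega
  no_cut_vertex a b hab hb := by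
    obtain ⟨x, y, h1, h2, h3, h4, hA⟩ := h.no_cut_vertex (-a + 1) (n - b) (by omega) (by omega)
    refine ⟨n - y, -x + n, by omega, by omega, by omega, by omega, ?_⟩
    rw [← h.add_left, ← h.add_right]
    convert h.symm _ _ hA using 1 <;> ring

/-- Otherwise both cycle edges at `s` would cross the chord over `s`. -/
theorem adj_or_adj_of_chord (h : IsPeriodicOnePHC n A) {s : ℤ} (hs : A (s - 1) (s + 1)) :
    A (s - 1) s ∨ A s (s + 1) := by
  by_contra! hcon
  obtain ⟨a, b, h1, h2, h3, ha, hb, -⟩ := h.exists_two s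
  have hne : ∀ c, s < c → c < s + n → A s c → s + 1 < c ∧ c < s - 1 + n := by
    intro c hc hcn hA
    refine ⟨lt_of_le_of_ne hc fun h0 => hcon.2 (h0 ▸ hA), lt_of_le_of_ne (by omega) fun h0 => ?_⟩
    subst h0
    exact hcon.1 (h.symm _ _ ((h.add_right _ _).1 hA))
  have hna := hne a h1 (by omega) ha
  have hnb := hne b (by omega) h3 hb
  have := h.crossing_unique (s - 1) (s + 1) s a s b (by omega) (by omega) hna.1 hna.2 (by omega)
    (by omega) hnb.1 hnb.2 hs ha hb
  omega

theorem chord_of_adj (h : IsPeriodicOnePHC n A) {s : ℤ}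
    (hs : A (s - 1) (s + 1)) (h1 : A s (s + 1)) (h0 : ¬ A (s - 1) s) : A s (s + 2) := by
  obtain ⟨d, hd, hdn, hA⟩ : ∃ d, s + 1 < d ∧ d < s - 1 + n ∧ A s d := by
    obtain ⟨a, b, hsa, hab, hb, hAa, hAb, hc⟩ := h.exists_two s
    refine ⟨b, by omega, lt_of_le_of_ne (by omega) fun h2 => ?_, hAb⟩
    subst h2
    exact h0 (h.symm _ _ ((h.add_right _ _).1 hAb))
  by_contra hcon
  have hd2 : s + 2 < d := lt_of_le_of_ne (by omega) fun h2 => hcon (h2 ▸ hA)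
  -- As `d` is not a cut vertex, some edge leaves the labels strictly between `s + 1` and `d` and
  -- avoids `d`. Either it crosses the edge `s d`, which the chord over `s` already crosses, or it
  -- ends at `s` or `s + 1`, which then has degree three.
  obtain ⟨x, y, hx, hxd, hdy, hy, hxy⟩ := h.no_cut_vertex (s + 2) d hd2 (by omega)
  rcases lt_trichotomy y (s + n) with hy1 | rfl | hy1
  · have := h.crossing_unique s d x y (s + 1) (s - 1 + n) (by omega) hxd hdy hy1 (by omega)
      (by omega) (by omega) (by omega) hA hxy ((h.add_right _ _).2 (h.symm _ _ hs))
    omega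
  · exact h.not_three (i := s) (a := s + 1) (b := x) (c := d) (by omega) (by omega) (by omega)
      (by omega) h1 (h.symm _ _ ((h.add_right _ _).1 hxy)) hA
  · obtain rfl : y = s + 1 + n := by omega
    exact h.not_three (i := s + 1) (a := x) (b := s - 1 + n) (c := s + n) (by omega) (by omega)
      (by omega) (by omega) (h.symm _ _ ((h.add_right _ _).1 hxy))
      ((h.add_right _ _).2 (h.symm _ _ hs)) ((h.add_right _ _).2 (h.symm _ _ h1))

/-- Every arc cut off by a chord contains two consecutive hull edges of the cycle, or a hull edge
at which two chords of length two cross. -/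
theorem exists_corner_or_cap (h : IsPeriodicOnePHC n A) {i j : ℤ} (hij : i + 2 ≤ j)
    (hj : j + 2 ≤ i + n) (hA : A i j) :
    ∃ s, (i < s ∧ s < j ∧ A (s - 1) s ∧ A s (s + 1)) ∨
      (i ≤ s ∧ s < j ∧ A s (s + 1) ∧ A (s - 1) (s + 1) ∧ A s (s + 2)) := by
  induction hm : (j - i).toNat using Nat.strong_induction_on generalizing i j with
  | _ m ih =>
  subst hm
  by_cases h2 : j = i + 2
  · obtain ⟨s, rfl⟩ : ∃ s, i = s - 1 := ⟨i + 1, by ring⟩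
    obtain rfl : j = s + 1 := by omega
    by_cases hl : A (s - 1) s
    · by_cases hr : A s (s + 1)
      · exact ⟨s, Or.inl ⟨by omega, by omega, hl, hr⟩⟩
      -- Mirror image of the other case; the hull edge of the cap now starts at `s - 1`.
      · have := h.neg.chord_of_adj (s := -s)
          (by convert h.symm _ _ hA using 1 <;> ring)
          (by convert h.symm _ _ hl using 1 <;> ring)
          (fun hh => hr (by convert h.symm _ _ hh using 1 <;> ring))
        refine ⟨s - 1, Or.inr ⟨by omega, by omega, by convert hl using 1; ring, ?_, ?_⟩⟩
        · convert h.symm _ _ this using 1 <;> ring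
        · convert hA using 1
          ring
    · have hr := (h.adj_or_adj_of_chord hA).resolve_left hl
      exact ⟨s, Or.inr ⟨by omega, by omega, hr, hA, h.chord_of_adj hA hr hl⟩⟩
  -- By induction no shorter chord lies within the arc, and no interior point has both hull edges.
  -- So every interior point sends an edge across the chord `i j`; there are at least two such
  -- points, one crossing too many.
  · by_contra hcon
    have hsub : ∀ i' j', i ≤ i' → j' ≤ j → i' + 2 ≤ j' → j' - i' < j - i → ¬ A i' j' := by
      intro i' j' h3 h4 h5 h6 h7
      obtain ⟨s, hs⟩ := ih _ (by omega) h5 (by omega) h7 rfl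
      refine hcon ⟨s, hs.imp ?_ ?_⟩
      · exact fun hs => ⟨by omega, by omega, hs.2.2⟩
      · exact fun hs => ⟨by omega, by omega, hs.2.2⟩
    have hint : ∀ s, i < s → s < j → ∃ d, j < d ∧ d < i + n ∧ A s d := by
      intro s hs hsj
      obtain ⟨a, b, h3, h4, h5, ha, hb, -⟩ := h.exists_two s
      have hc : ∀ c, s < c → c < s + n → A s c → c ≠ s + 1 → c ≠ s - 1 + n →
          ∃ d, j < d ∧ d < i + n ∧ A s d := by
        intro c hc1 hc2 hc3 hc4 hc5
        refine ⟨c, ?_, ?_, hc3⟩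
        · by_contra h6
          exact hsub s c (by omega) (by omega) (by omega) (by omega) hc3
        · by_contra h6
          refine hsub (c - n) s (by omega) (by omega) (by omega) (by omega) ?_
          rw [← h.add_left]
          convert h.symm _ _ hc3 using 1
          ring
      by_cases ha1 : a = s + 1
      · by_cases hb1 : b = s - 1 + n
        · subst ha1 hb1
          exact absurd ⟨s, Or.inl ⟨hs, hsj, h.symm _ _ ((h.add_right _ _).1 hb), ha⟩⟩ hcon
        · exact hc b (by omega) h5 hb (by omega) hb1
      · exact hc a h3 (by omega) ha ha1 (by omega)
    obtain ⟨d, hd1, hd2, hd⟩ := hint (i + 1) (by omega) (by omega)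
    obtain ⟨d', hd1', hd2', hd'⟩ := hint (i + 2) (by omega) (by omega)
    have := h.crossing_unique i j _ _ _ _ (by omega) (by omega) hd1 hd2 (by omega) (by omega)
      hd1' hd2' hA hd hd'
    omega

theorem adj_succ_of_no_chord (h : IsPeriodicOnePHC n A)
    (hno : ∀ i j : ℤ, i + 2 ≤ j → j + 2 ≤ i + n → ¬ A i j) (s : ℤ) : A s (s + 1) := by
  obtain ⟨a, b, h1, h2, h3, ha, hb, -⟩ := h.exists_two s
  by_cases h4 : a = s + 1
  · exact h4 ▸ ha
  · exact absurd ha (hno s a (by omega) (by omega))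

end IsPeriodicOnePHC

/-! ### Counting hull edges and corners, and the upper bound. -/

theorem List.length_le_card_filter_zmod {n : ℕ} [NeZero n] (Q : ZMod n → Prop) [DecidablePred Q]
    (l : List ℤ) (z : ℤ) (hl : l.Pairwise (· < ·)) (hz : ∀ s ∈ l, z ≤ s ∧ s < z + n)
    (hQ : ∀ s ∈ l, Q s) : l.length ≤ (Finset.univ.filter Q).card := by
  have hnd : l.Nodup := hl.imp (fun h => h.ne)
  rw [← List.toFinset_card_of_nodup hnd]
  refine Finset.card_le_card_of_injOn (fun s : ℤ => (s : ZMod n)) ?_ ?_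
  · intro s hs
    simpa using hQ s (by simpa using hs)
  · intro s hs t ht hst
    have h1 := hz s (by simpa using hs)
    have h2 := hz t (by simpa using ht)
    have h3 := (ZMod.intCast_eq_intCast_iff_dvd_sub _ _ _).1 hst
    have := Int.eq_zero_of_abs_lt_dvd h3 (by rw [abs_lt]; omega)
    omega

open Classical in
/-- The hull edges of the cycle, recorded by their first endpoint. -/
noncomputable def hullEdges {n : ℕ} [NeZero n] (B : ZMod n → ZMod n → Prop) : Finset (ZMod n) :=
  Finset.univ.filter fun s => B s (s + 1)

open Classical in
/-- The points that are cut off by a chord of length two, or at which the cycle follows the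
hull. -/
noncomputable def hullCorners {n : ℕ} [NeZero n] (B : ZMod n → ZMod n → Prop) :
    Finset (ZMod n) :=
  Finset.univ.filter fun s => B (s - 1) (s + 1) ∨ B (s - 1) s ∧ B s (s + 1)

theorem IsPeriodicOnePHC.six_le {n : ℕ} [NeZero n] (hn : 3 ≤ n) {B : ZMod n → ZMod n → Prop}
    (h : IsPeriodicOnePHC n (fun i j => B i j)) :
    6 ≤ (hullEdges B).card + (hullCorners B).card := by
  classical
  by_cases hno : ∃ i j : ℤ, i + 2 ≤ j ∧ j + 2 ≤ i + n ∧ B i j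
  · obtain ⟨i, j, hij, hj, hA⟩ := hno
    have hE : ∀ (l : List ℤ) (z : ℤ), l.Pairwise (· < ·) → (∀ s ∈ l, z ≤ s ∧ s < z + n) →
        (∀ s ∈ l, B s ((s + 1 : ℤ) : ZMod n)) → l.length ≤ (hullEdges B).card := by
      intro l z h1 h2 h3
      have := List.length_le_card_filter_zmod (fun s : ZMod n => B s (s + 1)) l z h1 h2
        (by simpa using h3)
      simpa [hullEdges, hullCorners] using this
    have hV : ∀ (l : List ℤ) (z : ℤ), l.Pairwise (· < ·) → (∀ s ∈ l, z ≤ s ∧ s < z + n) →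
        (∀ s ∈ l, B ((s - 1 : ℤ) : ZMod n) ((s + 1 : ℤ) : ZMod n) ∨
          B ((s - 1 : ℤ) : ZMod n) s ∧ B s ((s + 1 : ℤ) : ZMod n)) →
        l.length ≤ (hullCorners B).card := by
      intro l z h1 h2 h3
      have := List.length_le_card_filter_zmod
        (fun s : ZMod n => B (s - 1) (s + 1) ∨ B (s - 1) s ∧ B s (s + 1)) l z h1 h2
        (by simpa using h3)
      simpa [hullEdges, hullCorners] using this
    have hA' : B j ((i + n : ℤ) : ZMod n) := (h.add_right _ _).2 (h.symm _ _ hA)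
    obtain ⟨s, hs⟩ := h.exists_corner_or_cap hij hj hA
    obtain ⟨t, ht⟩ := h.exists_corner_or_cap (i := j) (j := i + n) (by omega) (by omega) hA'
    have e1 : ∀ s : ℤ, s - 1 + 1 = s := fun s => by ring
    have e2 : ∀ s : ℤ, s + 1 - 1 = s := fun s => by ring
    have e3 : ∀ s : ℤ, s + 1 + 1 = s + 2 := fun s => by ring
    rcases hs with ⟨hs1, hs2, hs3, hs4⟩ | ⟨hs1, hs2, hs3, hs4, hs5⟩ <;>
      rcases ht with ⟨ht1, ht2, ht3, ht4⟩ | ⟨ht1, ht2, ht3, ht4, ht5⟩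
    · have h1 := hE [s - 1, s, t - 1, t] i (by simp; omega) (by simp; omega)
        (by simp only [List.forall_mem_cons, e1]; simp_all)
      have h2 := hV [s, t] i (by simp; omega) (by simp; omega)
        (by simp only [List.forall_mem_cons]; simp_all)
      simp only [List.length_cons, List.length_nil] at h1 h2
      omega
    · have h1 := hE [s - 1, s, t] i (by simp; omega) (by simp; omega)
        (by simp only [List.forall_mem_cons, e1]; simp_all)
      have h2 := hV [s, t, t + 1] s (by simp; omega) (by simp; omega)
        (by simp only [List.forall_mem_cons, e2, e3]; simp_all)
      simp only [List.length_cons, List.length_nil] at h1 h2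
      omega
    · have h1 := hE [s, t - 1, t] i (by simp; omega) (by simp; omega)
        (by simp only [List.forall_mem_cons, e1]; simp_all)
      have h2 := hV [s, s + 1, t] s (by simp; omega) (by simp; omega)
        (by simp only [List.forall_mem_cons, e2, e3]; simp_all)
      simp only [List.length_cons, List.length_nil] at h1 h2
      omega
    -- Two caps give four distinct corners: caps sharing a corner would make it a vertex of degree
    -- three.
    · have hno : ∀ r : ℤ, B ((r - 1 : ℤ) : ZMod n) r → B ((r - 2 : ℤ) : ZMod n) r →
          ¬ B r ((r + 1 : ℤ) : ZMod n) := by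
        intro r h1 h2 h3
        exact h.not_three (i := r) (a := r + 1) (b := r - 2 + n) (c := r - 1 + n) (by omega)
          (by omega) (by omega) (by omega) h3 ((h.add_right _ _).2 (h.symm _ _ h2))
          ((h.add_right _ _).2 (h.symm _ _ h1))
      have hne1 : s + 1 ≠ t := by
        rintro rfl
        refine hno (s + 1) ?_ ?_ ht3
        · rw [e2]
          exact hs3
        · rw [show s + 1 - 2 = s - 1 by ring]
          exact hs4
      have hne2 : t + 1 ≠ s + n := by
        intro heq
        obtain rfl : t = s + n - 1 := by omega
        refine hno (s + n) ?_ ?_ ?_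
        · convert ht3 using 2
          ring
        · convert ht4 using 2 <;> ring
        · rw [show s + n + 1 = s + 1 + n by ring]
          exact (h.add_left _ _).2 ((h.add_right _ _).2 hs3)
      have h1 := hE [s, t] i (by simp; omega) (by simp; omega)
        (by simp only [List.forall_mem_cons]; simp_all)
      have h2 := hV [s, s + 1, t, t + 1] s (by simp; omega) (by simp; omega)
        (by simp only [List.forall_mem_cons, e2, e3]; simp_all)
      simp only [List.length_cons, List.length_nil] at h1 h2
      omega
  · have hall : ∀ s : ZMod n, B s (s + 1) := by
      intro s
      obtain ⟨s, rfl⟩ := ZMod.intCast_surjective s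
      have := h.adj_succ_of_no_chord (fun i j h1 h2 h3 => hno ⟨i, j, h1, h2, h3⟩) s
      simpa using this
    have h1 : hullEdges B = Finset.univ := by
      simp [hullEdges, hall]
    have h2 : hullCorners B = Finset.univ := by
      rw [hullCorners, Finset.filter_eq_self]
      intro s _
      exact Or.inr ⟨by simpa using hall (s - 1), hall s⟩
    -- The hull cycle scores `2 * n`, so `3 ≤ n` is exactly what is needed.
    rw [h1, h2, Finset.card_univ, ZMod.card]
    omega

theorem ZMod.exists_intCast_eq_of_ne {n : ℕ} [NeZero n] (i : ℤ) {z : ZMod n} (hz : z ≠ i) :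
    ∃ a : ℤ, i < a ∧ a < i + n ∧ (a : ZMod n) = z := by
  have h0 : (z - i).val ≠ 0 := by
    rw [Ne, ZMod.val_eq_zero, sub_eq_zero]
    exact hz
  have h1 := (z - i).val_lt
  exact ⟨i + (z - i).val, by omega, by omega, by simp⟩

theorem IsOnePHC.isPeriodicOnePHC {P : Finset Plane} {n : ℕ} [NeZero n] {v : ZMod n ≃ P}
    (hv : IsCyclicLabelling v) {G : SimpleGraph P} (hG : IsOnePHC G) :
    IsPeriodicOnePHC n (fun i j => G.Adj (v i) (v j)) where
  symm i j h := h.symm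
  add_left i j := by simp
  exists_two i := by
    obtain ⟨x, y, hxy, hS⟩ := Set.ncard_eq_two.1 (hG.1.ncard_neighborSet (v i))
    have hadj : ∀ z, G.Adj (v i) z ↔ z = x ∨ z = y := by
      intro z
      have : z ∈ G.neighborSet (v i) ↔ z ∈ ({x, y} : Set P) := by rw [hS]
      simpa using this
    have hlift : ∀ z, G.Adj (v i) z → ∃ a : ℤ, i < a ∧ a < i + n ∧ v a = z := by
      intro z hz
      obtain ⟨a, h1, h2, h3⟩ := ZMod.exists_intCast_eq_of_ne i (z := v.symm z)
        (fun h => hz.ne (by rw [← h]; simp))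
      exact ⟨a, h1, h2, by rw [h3]; simp⟩
    obtain ⟨a, ha1, ha2, rfl⟩ := hlift x ((hadj x).2 (Or.inl rfl))
    obtain ⟨b, hb1, hb2, rfl⟩ := hlift y ((hadj y).2 (Or.inr rfl))
    have hinj : ∀ c d : ℤ, i < c → c < i + n → i < d → d < i + n → v c = v d → c = d := by
      intro c d hc1 hc2 hd1 hd2 h
      have h3 := (ZMod.intCast_eq_intCast_iff_dvd_sub _ _ _).1 (v.injective h)
      have := Int.eq_zero_of_abs_lt_dvd h3 (by rw [abs_lt]; omega)
      omega
    have hc : ∀ c : ℤ, i < c → c < i + n → G.Adj (v i) (v c) → c = a ∨ c = b := by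
      intro c hc1 hc2 h
      exact ((hadj _).1 h).imp (hinj c a hc1 hc2 ha1 ha2) (hinj c b hc1 hc2 hb1 hb2)
    rcases lt_trichotomy a b with hab | rfl | hab
    · exact ⟨a, b, ha1, hab, hb2, (hadj _).2 (Or.inl rfl), (hadj _).2 (Or.inr rfl), hc⟩
    · exact absurd rfl hxy
    · exact ⟨b, a, hb1, hab, ha2, (hadj _).2 (Or.inr rfl), (hadj _).2 (Or.inl rfl),
        fun c h1 h2 h3 => (hc c h1 h2 h3).symm⟩
  crossing_unique a c b d b' d' h1 h2 h3 h4 h5 h6 h7 h8 hac hbd hbd' := by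
    have hX := hv.edgesCross h1 h2 h3 h4
    have hX' := hv.edgesCross h5 h6 h7 h8
    have heq := Set.encard_le_one_iff.1 (hG.2 s(v a, v c) hac) _ _ ⟨hbd, hX⟩ ⟨hbd', hX'⟩
    have hinj : ∀ e f : ℤ, a < e → e < a + n → a < f → f < a + n → v e = v f → e = f := by
      intro c d hc1 hc2 hd1 hd2 h
      have h3 := (ZMod.intCast_eq_intCast_iff_dvd_sub _ _ _).1 (v.injective h)
      have := Int.eq_zero_of_abs_lt_dvd h3 (by rw [abs_lt]; omega)
      omega
    rcases Sym2.eq_iff.1 heq with ⟨h9, h10⟩ | ⟨h9, h10⟩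
    · exact ⟨hinj _ _ (by omega) (by omega) (by omega) (by omega) h9,
        hinj _ _ (by omega) (by omega) (by omega) (by omega) h10⟩
    · have := hinj _ _ (by omega) (by omega) (by omega) (by omega) h9
      omega
  no_cut_vertex a b hab hb := by
    have hinj : ∀ e f : ℤ, e < f → f < e + n → v e ≠ v f := by
      intro c d hc1 hc2 h
      have h3 := (ZMod.intCast_eq_intCast_iff_dvd_sub _ _ _).1 (v.injective h)
      have := Int.eq_zero_of_abs_lt_dvd h3 (by rw [abs_lt]; omega)
      omega
    obtain ⟨_, ⟨x, hx1, hx2, rfl⟩, y, hy, hyb, hadj⟩ := hG.1.exists_adj_of_notMem (v b)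
      {z | ∃ x : ℤ, a ≤ x ∧ x < b ∧ v x = z} (x := v a) (y := v (b + 1 : ℤ))
      (fun ⟨x, hx1, hx2, hx⟩ => hinj x b hx2 (by omega) hx) ⟨a, le_rfl, hab, rfl⟩
      (fun ⟨x, hx1, hx2, hx⟩ => hinj x (b + 1) (by omega) (by omega) hx)
      (hinj b (b + 1) (by omega) (by omega)).symm
    obtain ⟨y', h1, h2, h3⟩ := ZMod.exists_intCast_eq_of_ne b (z := v.symm y)
      (fun h => hyb (by rw [← h]; simp))
    have hy' : v y' = y := by rw [h3]; simp
    refine ⟨x, y', hx1, hx2, h1, ?_, by rwa [hy']⟩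
    by_contra hcon
    exact hy ⟨y' - n, by omega, by omega, by simpa using hy'⟩

theorem IsOnePHCPacking.three_mul_le {P : Finset Plane} {n : ℕ} [NeZero n] {v : ZMod n ≃ P}
    (hv : IsCyclicLabelling v) (hn : 3 ≤ n) {k : ℕ} {C : Fin k → SimpleGraph P}
    (hC : IsOnePHCPacking k C) : 3 * k ≤ n := by
  classical
  set B : Fin k → ZMod n → ZMod n → Prop := fun i x y => (C i).Adj (v x) (v y)
  have hper : ∀ i, IsPeriodicOnePHC n (fun x y => B i x y) := fun i =>
    (hC.1 i).isPeriodicOnePHC hv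
  have hdis : ∀ i j, i ≠ j → ∀ x y, B i x y → ¬ B j x y := by
    intro i j hij x y h1 h2
    exact Set.disjoint_left.1 (hC.2 i j hij) (show s(v x, v y) ∈ _ from h1) h2
  have hE : ∑ i, (hullEdges (B i)).card ≤ n := by
    rw [← Finset.card_biUnion]
    · exact (Finset.card_le_univ _).trans (ZMod.card n).le
    · intro i _ j _ hij
      rw [Function.onFun, Finset.disjoint_left]
      intro s hi hj
      simp only [hullEdges, Finset.mem_filter] at hi hj
      exact hdis i j hij _ _ hi.2 hj.2
  have hmix : ∀ i j, i ≠ j → ∀ s, B i (s - 1) (s + 1) → ¬ (B j (s - 1) s ∧ B j s (s + 1)) := by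
    intro i j hij s h1 h2
    obtain ⟨s, rfl⟩ := ZMod.intCast_surjective s
    have := (hper i).adj_or_adj_of_chord (s := s) (by simpa using h1)
    push_cast at this
    rcases this with h3 | h3
    · exact hdis i j hij _ _ h3 h2.1
    · exact hdis i j hij _ _ h3 h2.2
  have hV : ∑ i, (hullCorners (B i)).card ≤ n := by
    rw [← Finset.card_biUnion]
    · exact (Finset.card_le_univ _).trans (ZMod.card n).le
    · intro i _ j _ hij
      rw [Function.onFun, Finset.disjoint_left]
      intro s hi hj
      simp only [hullCorners, Finset.mem_filter] at hi hj
      rcases hi.2 with hi | hi <;> rcases hj.2 with hj | hj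
      · exact hdis i j hij _ _ hi hj
      · exact hmix i j hij s hi hj
      · exact hmix j i hij.symm s hj hi
      · exact hdis i j hij _ _ hi.1 hj.1
  have h6 : ∑ _i : Fin k, 6 ≤ ∑ i, ((hullEdges (B i)).card + (hullCorners (B i)).card) :=
    Finset.sum_le_sum fun i _ => (hper i).six_le hn
  rw [Finset.sum_add_distrib] at h6
  simp only [Finset.sum_const, Finset.card_univ, Fintype.card_fin, smul_eq_mul] at h6
  omega

/-! ### Zigzag cycles and the packing. -/

/-- The pairs that occur as edges of the zigzag cycle with axis `p`: the reflections `x ↦ p ± 1 - x`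
swap the two points, or the points span a hull edge perpendicular to the axis. -/
def ZigzagPair {n : ℕ} (p x y : ZMod n) : Prop :=
  x + y = p - 1 ∨ x + y = p + 1 ∨ x + y = p ∧ (y = x + 1 ∨ x = y + 1)

theorem ZigzagPair.symm {n : ℕ} {p x y : ZMod n} (h : ZigzagPair p x y) : ZigzagPair p y x := by
  unfold ZigzagPair at *
  rw [add_comm y x]
  tauto

/-- The zigzag as an integer sequence: `n` values, distinct modulo `n`, whose steps and closing step
are zigzag pairs. The parity hypothesis leaves out only odd `q` with odd `n`, where `q + n` can
serve instead. -/
theorem exists_zigzag_int (n : ℕ) (q : ℤ) (h : q % 2 = 0 ∨ n % 2 = 0) :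
    ∃ (f : ℤ → ℤ) (l : ℤ),
      (∀ k k', l ≤ k → k < k' → k' < l + n → f k ≠ f k' ∧ f k - f k' < n ∧ f k' - f k < n) ∧
      (∀ k, l ≤ k → k + 1 < l + n → f k + f (k + 1) = q - 1 ∨ f k + f (k + 1) = q + 1 ∨
        f k + f (k + 1) = q ∧ (f (k + 1) = f k + 1 ∨ f k = f (k + 1) + 1)) ∧
      ∃ c : ℤ, f (l + n - 1) + f l = q - 1 + n * c ∨ f (l + n - 1) + f l = q + 1 + n * c ∨
        f (l + n - 1) + f l = q ∧ (f l = f (l + n - 1) + 1 + n * c ∨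
          f (l + n - 1) = f l + 1 + n * c) := by
  rcases Int.even_or_odd' q with ⟨x, rfl | rfl⟩
  -- The axis passes through `x`. The signs in `x ± k` alternate, so consecutive sums are `q ± 1`;
  -- the window of `n` indices is centred at `0` as nearly as possible.
  · refine ⟨fun k => if k % 2 = 0 then x - k else x + k, -((n - 1) / 2), ?_, ?_, ?_⟩
    · intro k k' h1 h2 h3
      dsimp only
      split_ifs <;> omega
    · intro k h1 h2
      dsimp only
      split_ifs <;> omega
    · rcases Nat.even_or_odd' n with ⟨m, rfl | rfl⟩
      · rcases Nat.even_or_odd' m with ⟨r, rfl | rfl⟩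
        · refine ⟨-1, ?_⟩
          dsimp only
          split_ifs <;> push_cast <;> omega
        · refine ⟨1, ?_⟩
          dsimp only
          split_ifs <;> push_cast <;> omega
      · rcases Nat.even_or_odd' m with ⟨r, rfl | rfl⟩
        · refine ⟨-1, ?_⟩
          dsimp only
          split_ifs <;> push_cast <;> omega
        · refine ⟨-1, ?_⟩
          dsimp only
          split_ifs <;> push_cast <;> omega
  · obtain ⟨m, rfl⟩ : ∃ m, n = 2 * m := ⟨n / 2, by omega⟩
    -- The axis bisects the hull edge from `x` to `x + 1`, which is the step from `0` to `1`, so the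
    -- parity pattern switches there. The closing step is the opposite hull edge, again of sum `q`.
    refine ⟨fun k => if (k % 2 = 0 ↔ k ≤ 0) then x + k else x + 1 - k, -m + 1, ?_, ?_, ?_⟩
    · intro k k' h1 h2 h3
      dsimp only
      push_cast at *
      split_ifs <;> omega
    · intro k h1 h2
      dsimp only
      push_cast at *
      split_ifs <;> omega
    · rcases Nat.even_or_odd' m with ⟨r, rfl | rfl⟩
      · refine ⟨-1, ?_⟩
        dsimp only
        split_ifs <;> push_cast at * <;> omega
      · refine ⟨-1, ?_⟩
        dsimp only
        split_ifs <;> push_cast at * <;> omega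

theorem exists_zigzag {n : ℕ} (p : ZMod (n + 3)) :
    ∃ σ : Fin (n + 3) → ZMod (n + 3), Function.Injective σ ∧
      ∀ i j, (SimpleGraph.cycleGraph (n + 3)).Adj i j → ZigzagPair p (σ i) (σ j) := by
  obtain ⟨q, hq, rfl⟩ : ∃ q : ℤ, (q % 2 = 0 ∨ (n + 3) % 2 = 0) ∧ (q : ZMod (n + 3)) = p := by
    obtain ⟨q, rfl⟩ := ZMod.intCast_surjective p
    by_cases h : q % 2 = 0 ∨ (n + 3) % 2 = 0
    · exact ⟨q, h, rfl⟩
    · refine ⟨q + (n + 3 : ℕ), Or.inl (by push_cast; omega), ?_⟩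
      rw [Int.cast_add, Int.cast_natCast, ZMod.natCast_self, add_zero]
  obtain ⟨f, l, hinj, hstep, c, hclose⟩ := exists_zigzag_int (n + 3) q hq
  have hcast : ∀ a b c : ℤ, a = b + (n + 3 : ℕ) * c → (a : ZMod (n + 3)) = b := by
    rintro a b c rfl
    rw [Int.cast_add, Int.cast_mul, Int.cast_natCast, ZMod.natCast_self, zero_mul, add_zero]
  have hsucc : ∀ u : Fin (n + 3),
      ZigzagPair (q : ZMod (n + 3)) (f (l + u.val) : ZMod (n + 3)) (f (l + (u + 1).val)) := by
    intro u
    have hu := u.isLt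
    by_cases hlast : u.val = n + 2
    · have h0 : (u + 1).val = 0 := by
        rw [Fin.val_add, hlast]
        simp
      rw [h0, hlast, show l + ((n + 2 : ℕ) : ℤ) = l + (n + 3 : ℕ) - 1 by push_cast; ring,
        Nat.cast_zero, add_zero]
      rcases hclose with h | h | ⟨h, h'⟩
      · left
        simpa using hcast _ _ _ h
      · right; left
        simpa using hcast _ _ _ h
      · right; right
        refine ⟨by exact_mod_cast congrArg (Int.cast : ℤ → ZMod (n + 3)) h, h'.imp ?_ ?_⟩
        · intro h'
          simpa using hcast _ _ _ h'
        · intro h'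
          simpa using hcast _ _ _ h'
    · have h1 : (u + 1).val = u.val + 1 := by
        rw [Fin.val_add]
        simp only [Fin.val_one]
        exact Nat.mod_eq_of_lt (by omega)
      rw [h1]
      have h2 := hstep (l + u.val) (by omega) (by push_cast; omega)
      push_cast
      rw [← add_assoc]
      rcases h2 with h | h | ⟨h, h'⟩
      · left
        simpa using congrArg (Int.cast : ℤ → ZMod (n + 3)) h
      · right; left
        simpa using congrArg (Int.cast : ℤ → ZMod (n + 3)) h
      · right; right
        refine ⟨by simpa using congrArg (Int.cast : ℤ → ZMod (n + 3)) h, h'.imp ?_ ?_⟩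
        · intro h'
          simpa using congrArg (Int.cast : ℤ → ZMod (n + 3)) h'
        · intro h'
          simpa using congrArg (Int.cast : ℤ → ZMod (n + 3)) h'
  refine ⟨fun i => f (l + i.val), ?_, ?_⟩
  · have hlt : ∀ i j : Fin (n + 3), i < j →
        (f (l + i.val) : ZMod (n + 3)) ≠ f (l + j.val) := by
      intro i j hij heq
      have hj := j.isLt
      have h := hinj (l + i.val) (l + j.val) (by omega) (by omega) (by push_cast; omega)
      have h1 := (ZMod.intCast_eq_intCast_iff_dvd_sub _ _ _).1 heq
      have := Int.eq_zero_of_abs_lt_dvd h1 (by rw [abs_lt]; omega)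
      omega
    intro i j hij
    rcases lt_trichotomy i j with h | h | h
    · exact absurd hij (hlt i j h)
    · exact h
    · exact absurd hij.symm (hlt j i h)
  · intro i j hij
    rcases SimpleGraph.cycleGraph_adj.1 hij with h | h
    · have := hsucc j
      rw [show j + 1 = i by rw [← h]; abel] at this
      exact this.symm
    · have := hsucc i
      rwa [show i + 1 = j by rw [← h]; abel] at this

/-- Interlacing forces `2 ≤ b + d - (a + c) ≤ n - 2`. Modulo `n` this difference is `0`, `2` or
`-2`: the first is impossible and the others are attained only at the two extremes, where one edge
is the other shifted by one. -/
theorem ZigzagPair.eq_map_of_cross {n : ℕ} {p a b c d : ℤ} (hab : a < b) (hbc : b < c)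
    (hcd : c < d) (hd : d < a + n) (h1 : ZigzagPair (p : ZMod n) a c)
    (h2 : ZigzagPair (p : ZMod n) b d) :
    ((a + c : ZMod n) = p - 1 ∧
      s((b : ZMod n), (d : ZMod n)) = s((a : ZMod n), (c : ZMod n)).map (· + 1)) ∨
    ((a + c : ZMod n) = p + 1 ∧
      s((b : ZMod n), (d : ZMod n)) = s((a : ZMod n), (c : ZMod n)).map (· - 1)) := by
  have hz : ∀ z : ℤ, 0 ≤ z → z < n → (z : ZMod n) = 0 → z = 0 := by
    intro z h0 hlt hz
    rw [ZMod.intCast_zmod_eq_zero_iff_dvd] at hz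
    exact Int.eq_zero_of_dvd_of_nonneg_of_lt h0 hlt hz
  have hsucc : ∀ x y : ℤ, x + 1 < y → y + 1 < x + n →
      ¬ ((y : ZMod n) = x + 1 ∨ (x : ZMod n) = y + 1) := by
    rintro x y hx hy (h | h)
    · have := hz (y - (x + 1)) (by omega) (by omega) (by push_cast; rw [h]; ring)
      omega
    · have := hz (x + n - (y + 1)) (by omega) (by omega) (by push_cast; rw [h]; simp)
      omega
  have h1' : (a + c : ZMod n) = p - 1 ∨ (a + c : ZMod n) = p + 1 := by
    rcases h1 with h | h | ⟨-, h⟩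
    · exact Or.inl h
    · exact Or.inr h
    · exact absurd h (hsucc a c (by omega) (by omega))
  have h2' : (b + d : ZMod n) = p - 1 ∨ (b + d : ZMod n) = p + 1 := by
    rcases h2 with h | h | ⟨-, h⟩
    · exact Or.inl h
    · exact Or.inr h
    · exact absurd h (hsucc b d (by omega) (by omega))
  have hne : (a + c : ZMod n) ≠ b + d := by
    intro h
    have := hz (b + d - (a + c)) (by omega) (by omega) (by push_cast; rw [h]; ring)
    omega
  rcases h1' with h1 | h1 <;> rcases h2' with h2 | h2
  · exact absurd (h1.trans h2.symm) hne
  · have := hz (b + d - (a + c) - 2) (by omega) (by omega) (by push_cast; rw [h1, h2]; ring)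
    obtain rfl : b = a + 1 := by omega
    obtain rfl : d = c + 1 := by omega
    exact Or.inl ⟨h1, by simp⟩
  · have := hz (a + c + n - (b + d) - 2) (by omega) (by omega)
      (by push_cast; rw [h1, h2, ZMod.natCast_self]; ring)
    obtain rfl : b = c - 1 := by omega
    obtain rfl : d = a - 1 + n := by omega
    refine Or.inr ⟨h1, ?_⟩
    rw [Sym2.eq_swap]
    simp
  · exact absurd (h1.trans h2.symm) hne

theorem isOnePlane_of_zigzagPair {P : Finset Plane} {n : ℕ} [NeZero n] (hn : 3 ≤ n)
    {v : ZMod n ≃ P} (hv : IsCyclicLabelling v) {G : SimpleGraph P} (p : ZMod n)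
    (hG : ∀ x y, G.Adj (v x) (v y) → ZigzagPair p x y) : IsOnePlane G := by
  obtain ⟨p, rfl⟩ := ZMod.intCast_surjective p
  -- Hence the sum of an edge determines the direction of the shift, and with it the only edge that
  -- can cross it.
  have hp : (p - 1 : ZMod n) ≠ p + 1 := by
    intro h
    have h2 : ((2 : ℕ) : ZMod n) = 0 := by
      push_cast
      linear_combination -h
    rw [ZMod.natCast_eq_zero_iff] at h2
    have := Nat.le_of_dvd (by norm_num) h2
    omega
  have key : ∀ x y z w : ZMod n, G.Adj (v x) (v y) → G.Adj (v z) (v w) →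
      EdgesCross s(v x, v y) s(v z, v w) →
      (x + y = p - 1 ∧ s(z, w) = s(x, y).map (· + 1)) ∨
        (x + y = p + 1 ∧ s(z, w) = s(x, y).map (· - 1)) := by
    intro x y z w hxy hzw hX
    obtain ⟨a, b, c, d, h1, h2, h3, h4, h5, h6⟩ := hv.exists_of_edgesCross
      (fun h => hxy.ne (by rw [h])) (fun h => hzw.ne (by rw [h])) hX
    have hac : ZigzagPair (p : ZMod n) a c := by
      rcases Sym2.eq_iff.1 h5 with ⟨h, h'⟩ | ⟨h, h'⟩ <;> rw [h, h']
      · exact hG _ _ hxy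
      · exact hG _ _ hxy.symm
    have hbd : ZigzagPair (p : ZMod n) b d := by
      rcases Sym2.eq_iff.1 h6 with ⟨h, h'⟩ | ⟨h, h'⟩ <;> rw [h, h']
      · exact hG _ _ hzw
      · exact hG _ _ hzw.symm
    have hsum : (a + c : ZMod n) = x + y := by
      rcases Sym2.eq_iff.1 h5 with ⟨h, h'⟩ | ⟨h, h'⟩ <;> rw [h, h']
      exact add_comm _ _
    have := ZigzagPair.eq_map_of_cross h1 h2 h3 h4 hac hbd
    rwa [hsum, h5, h6] at this
  intro e he
  rw [Set.encard_le_one_iff]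
  rintro f f' ⟨hf, hX⟩ ⟨hf', hX'⟩
  induction e with | _ a b =>
  induction f with | _ c d =>
  induction f' with | _ c' d' =>
  obtain ⟨x, rfl⟩ := v.surjective a
  obtain ⟨y, rfl⟩ := v.surjective b
  obtain ⟨z, rfl⟩ := v.surjective c
  obtain ⟨w, rfl⟩ := v.surjective d
  obtain ⟨z', rfl⟩ := v.surjective c'
  obtain ⟨w', rfl⟩ := v.surjective d'
  have heq : s(z, w) = s(z', w') := by
    rcases key x y z w he hf hX with ⟨h1, h2⟩ | ⟨h1, h2⟩ <;>
      rcases key x y z' w' he hf' hX' with ⟨h1', h2'⟩ | ⟨h1', h2'⟩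
    · rw [h2, h2']
    · exact absurd (h1.symm.trans h1') hp
    · exact absurd (h1'.symm.trans h1) hp
    · rw [h2, h2']
  exact congrArg (Sym2.map v) heq

theorem exists_zigzag_isOnePHC {P : Finset Plane} {n : ℕ} (hcard : P.card = n + 3)
    {v : ZMod (n + 3) ≃ P} (hv : IsCyclicLabelling v) (p : ZMod (n + 3)) :
    ∃ G : SimpleGraph P, IsOnePHC G ∧ ∀ x y, G.Adj (v x) (v y) → ZigzagPair p x y := by
  obtain ⟨σ, hσ, hadj⟩ := exists_zigzag p
  let τ : Fin (n + 3) ≃ P := Equiv.ofBijective (v ∘ σ)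
    ((Fintype.bijective_iff_injective_and_card _).2 ⟨v.injective.comp hσ, by simp [hcard]⟩)
  have hG : ∀ x y, ((SimpleGraph.cycleGraph (n + 3)).map τ.toEmbedding).Adj (v x) (v y) →
      ZigzagPair p x y := by
    intro x y hxy
    rw [SimpleGraph.map_adj] at hxy
    obtain ⟨i, j, hij, hi, hj⟩ := hxy
    have hi' : σ i = x := v.injective hi
    have hj' : σ j = y := v.injective hj
    rw [← hi', ← hj']
    exact hadj i j hij
  exact ⟨_, ⟨isHamiltonianCycleGraph_map_cycleGraph τ,
    isOnePlane_of_zigzagPair (by omega) hv p hG⟩, hG⟩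

theorem exists_isOnePHCPacking {P : Finset Plane} {n : ℕ} (hcard : P.card = n + 3)
    {v : ZMod (n + 3) ≃ P} (hv : IsCyclicLabelling v) {k : ℕ} (hk : 3 * k ≤ n + 3) :
    ∃ C : Fin k → SimpleGraph P, IsOnePHCPacking k C := by
  choose C hC hadj using fun i : Fin k =>
    exists_zigzag_isOnePHC hcard hv ((3 * i.val : ℤ) : ZMod (n + 3))
  refine ⟨C, hC, fun i j hij => ?_⟩
  rw [Set.disjoint_left]
  intro e hi hj
  induction e with | _ a b =>
  obtain ⟨x, rfl⟩ := v.surjective a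
  obtain ⟨y, rfl⟩ := v.surjective b
  have hnear : ∀ i, (C i).Adj (v x) (v y) →
      ∃ δ : ℤ, -1 ≤ δ ∧ δ ≤ 1 ∧ x + y = ((3 * i.val + δ : ℤ) : ZMod (n + 3)) := by
    intro i h
    rcases hadj i x y h with h | h | ⟨h, -⟩
    · exact ⟨-1, by norm_num, by norm_num, by rw [h]; push_cast; ring⟩
    · exact ⟨1, by norm_num, by norm_num, by rw [h]; push_cast; ring⟩
    · exact ⟨0, by norm_num, by norm_num, by rw [h]; push_cast; ring⟩
  obtain ⟨δ, h1, h2, h3⟩ := hnear i hi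
  obtain ⟨ε, h4, h5, h6⟩ := hnear j hj
  have h7 := (ZMod.intCast_eq_intCast_iff_dvd_sub _ _ _).1 (h3.symm.trans h6)
  have hne : i.val ≠ j.val := fun h => hij (Fin.ext h)
  have := i.isLt
  have := j.isLt
  -- The two sums differ by at most `3 * (k - 1) + 2 < n`, and by at least `1` because `i ≠ j`.
  have := Int.eq_zero_of_abs_lt_dvd h7 (by rw [abs_lt]; push_cast; omega)
  omega

theorem theorem1 (n : ℕ) (hn : 3 ≤ n) (P : Finset Plane) (hcard : P.card = n)
    (hP : InConvexPosition P) (k : ℕ) :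
    (∃ C : Fin k → SimpleGraph P, IsOnePHCPacking k C) ↔ k ≤ n / 3 := by
  obtain ⟨v, hv⟩ := exists_isCyclicLabelling hP hcard (by omega)
  obtain ⟨m, rfl⟩ : ∃ m, n = m + 3 := ⟨n - 3, by omega⟩
  constructor
  · rintro ⟨C, hC⟩
    have := hC.three_mul_le hv hn
    omega
  · intro hk
    exact exists_isOnePHCPacking hcard hv (by omega)
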